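/- Let $\mathcal H_0,\mathcal H_1,\mathcal K_1$ be complex Hilbert spaces, and let $T_0\in\mathcal B(\mathcal H_0)$, $T_1\in\mathcal B(\mathcal H_1)$, $V_1\in\mathcal B(\mathcal K_1)$, $K\in\mathcal B(\mathcal H_1,\mathcal K_1)$, $A\in\mathcal B(\mathcal H_1,\mathcal H_0)$ be bounded linear operators. Let $\mathcal H=\mathcal H_0\oplus\mathcal H_1$ and $\mathcal K=\mathcal K_1\oplus\mathcal H_1$ be the orthogonal sums, and set $$V=\begin{pmatrix}V_1&K\\0&T_1\end{pmatrix}\in\mathcal B(\mathcal K),\qquad R=\begin{pmatrix}T_0&A\\0&T_1\end{pmatrix}\in\mathcal B(\mathcal H),\qquad R_0=\begin{pmatrix}T_0&0&A\\0&V_1&K\\0&0&T_1\end{pmatrix}\in\mathcal B(\mathcal H_0\oplus\mathcal K_1\oplus\mathcal H_1)=\mathcal B(\mathcal H_0\oplus\mathcal K).$$ An operator $S$ is called power bounded if $\sup_{n\ge1}\|S^n\|<\infty$, and polynomially bounded if there is a constant $M>0$ such that $\|p(S)\|\le M\sup\{|p(z)|:|z|\le1\}$ for every complex polynomial $p$.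 It is similar to a contraction if there are a Hilbert space $\mathcal L$, an operator $T\in\mathcal B(\mathcal L)$ with $\|T\|\le1$, and a bounded operator $X$ with bounded inverse from the space of $S$ onto $\mathcal L$ such that $XS=TX$. Then $\mathcal K_1$ is an invariant subspace of $R_0$, and with respect to the representation of $\mathcal H_0\oplus\mathcal K$ as $\mathcal K_1\oplus\mathcal H$ (permuting the components) $R_0$ has the form $$R_0=\begin{pmatrix}V_1&B\\0&R\end{pmatrix}\quad\text{for some } B\in\mathcal B(\mathcal H,\mathcal K_1).$$ Moreover: (1) If $V$ is power bounded, then $R$ is power bounded if and only if $R_0$ is power bounded. If $V$ is polynomially bounded, then $R$ is polynomially bounded if and only if $R_0$ is polynomially bounded. (2) If $V$ is an isometry, then $R$ is similar to a contraction if and only if $R_0$ is similar to a contraction. -/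

import Mathlib

noncomputable section

namespace BlockOperators

universe u v w

section Classes

/-- `R` is power bounded: `sup_{n ≥ 1} ‖R ^ n‖ < ∞`. -/
def PowerBounded {H : Type u} [NormedAddCommGroup H] [InnerProductSpace ℂ H]
    (R : H →L[ℂ] H) : Prop :=
  ∃ C : ℝ, ∀ n : ℕ, 1 ≤ n → ‖R ^ n‖ ≤ C

/-- `R` is polynomially bounded: for some `M > 0` every complex polynomial `p` satisfies
`‖p(R)‖ ≤ M * sup {|p(z)| : |z| ≤ 1}`. -/
def PolynomiallyBounded {H : Type u} [NormedAddCommGroup H] [InnerProductSpace ℂ H]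
    (R : H →L[ℂ] H) : Prop :=
  ∃ M : ℝ, 0 < M ∧ ∀ p : Polynomial ℂ,
    ‖Polynomial.aeval R p‖ ≤ M * ⨆ z : Metric.closedBall (0 : ℂ) 1, ‖p.eval (z : ℂ)‖

/-- `R` and `T` are similar: `X R = T X` for some bounded operator `X` with a bounded inverse. -/
def Similar {H : Type u} {L : Type v} [NormedAddCommGroup H] [InnerProductSpace ℂ H]
    [NormedAddCommGroup L] [InnerProductSpace ℂ L]
    (R : H →L[ℂ] H) (T : L →L[ℂ] L) : Prop :=
  ∃ X : H ≃L[ℂ] L, (X : H →L[ℂ] L) ∘L R = T ∘L (X : H →L[ℂ] L)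

/-- `R` is similar to a contraction, acting on some Hilbert space. -/
def SimilarToContraction {H : Type u} [NormedAddCommGroup H] [InnerProductSpace ℂ H]
    (R : H →L[ℂ] H) : Prop :=
  ∃ (L : Type u) (_ : NormedAddCommGroup L) (_ : InnerProductSpace ℂ L) (_ : CompleteSpace L)
    (T : L →L[ℂ] L), ‖T‖ ≤ 1 ∧ Similar R T

end Classes

section Blocks

variable {E : Type u} {F : Type v} {G : Type w}
  [NormedAddCommGroup E] [InnerProductSpace ℂ E]
  [NormedAddCommGroup F] [InnerProductSpace ℂ F]
  [NormedAddCommGroup G] [InnerProductSpace ℂ G]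

/-- The operator on the orthogonal sum `E ⊕ F` with the given `2 × 2` operator matrix
(rows listed from the top). -/
def block2 (a₁₁ : E →L[ℂ] E) (a₁₂ : F →L[ℂ] E) (a₂₁ : E →L[ℂ] F) (a₂₂ : F →L[ℂ] F) :
    WithLp 2 (E × F) →L[ℂ] WithLp 2 (E × F) :=
  ((WithLp.prodContinuousLinearEquiv 2 ℂ E F).symm : (E × F) →L[ℂ] WithLp 2 (E × F)) ∘L
    ((a₁₁ ∘L WithLp.fstL 2 ℂ E F + a₁₂ ∘L WithLp.sndL 2 ℂ E F).prod
      (a₂₁ ∘L WithLp.fstL 2 ℂ E F + a₂₂ ∘L WithLp.sndL 2 ℂ E F))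

theorem block2_apply (a₁₁ : E →L[ℂ] E) (a₁₂ : F →L[ℂ] E) (a₂₁ : E →L[ℂ] F) (a₂₂ : F →L[ℂ] F)
    (x : WithLp 2 (E × F)) :
    block2 a₁₁ a₁₂ a₂₁ a₂₂ x =
      WithLp.toLp 2 (a₁₁ x.fst + a₁₂ x.snd, a₂₁ x.fst + a₂₂ x.snd) := rfl

/-- The operator on the orthogonal sum `E ⊕ (F ⊕ G)` with the given `3 × 3` operator matrix
with respect to `E`, `F`, `G` (rows listed from the top). -/
def block3
    (a₁₁ : E →L[ℂ] E) (a₁₂ : F →L[ℂ] E) (a₁₃ : G →L[ℂ] E)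
    (a₂₁ : E →L[ℂ] F) (a₂₂ : F →L[ℂ] F) (a₂₃ : G →L[ℂ] F)
    (a₃₁ : E →L[ℂ] G) (a₃₂ : F →L[ℂ] G) (a₃₃ : G →L[ℂ] G) :
    WithLp 2 (E × WithLp 2 (F × G)) →L[ℂ] WithLp 2 (E × WithLp 2 (F × G)) :=
  let π₁ : WithLp 2 (E × WithLp 2 (F × G)) →L[ℂ] E := WithLp.fstL 2 ℂ E (WithLp 2 (F × G))
  let π₂ : WithLp 2 (E × WithLp 2 (F × G)) →L[ℂ] F :=
    WithLp.fstL 2 ℂ F G ∘L WithLp.sndL 2 ℂ E (WithLp 2 (F × G))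
  let π₃ : WithLp 2 (E × WithLp 2 (F × G)) →L[ℂ] G :=
    WithLp.sndL 2 ℂ F G ∘L WithLp.sndL 2 ℂ E (WithLp 2 (F × G))
  ((WithLp.prodContinuousLinearEquiv 2 ℂ E (WithLp 2 (F × G))).symm :
      (E × WithLp 2 (F × G)) →L[ℂ] WithLp 2 (E × WithLp 2 (F × G))) ∘L
    ((a₁₁ ∘L π₁ + a₁₂ ∘L π₂ + a₁₃ ∘L π₃).prod
      (((WithLp.prodContinuousLinearEquiv 2 ℂ F G).symm : (F × G) →L[ℂ] WithLp 2 (F × G)) ∘L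
        ((a₂₁ ∘L π₁ + a₂₂ ∘L π₂ + a₂₃ ∘L π₃).prod
          (a₃₁ ∘L π₁ + a₃₂ ∘L π₂ + a₃₃ ∘L π₃))))

theorem block3_apply
    (a₁₁ : E →L[ℂ] E) (a₁₂ : F →L[ℂ] E) (a₁₃ : G →L[ℂ] E)
    (a₂₁ : E →L[ℂ] F) (a₂₂ : F →L[ℂ] F) (a₂₃ : G →L[ℂ] F)
    (a₃₁ : E →L[ℂ] G) (a₃₂ : F →L[ℂ] G) (a₃₃ : G →L[ℂ] G)
    (x : WithLp 2 (E × WithLp 2 (F × G))) :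
    block3 a₁₁ a₁₂ a₁₃ a₂₁ a₂₂ a₂₃ a₃₁ a₃₂ a₃₃ x =
      WithLp.toLp 2 (a₁₁ x.fst + a₁₂ x.snd.fst + a₁₃ x.snd.snd,
        WithLp.toLp 2 (a₂₁ x.fst + a₂₂ x.snd.fst + a₂₃ x.snd.snd,
          a₃₁ x.fst + a₃₂ x.snd.fst + a₃₃ x.snd.snd)) := rfl

variable (E F G)

/-- The summand `F` of `E ⊕ (F ⊕ G)`, as a subspace: the vectors whose components in `E` and `G`
vanish. -/
def middleSummand : Submodule ℂ (WithLp 2 (E × WithLp 2 (F × G))) where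
  carrier := {x | x.fst = 0 ∧ x.snd.snd = 0}
  add_mem' := by
    rintro x y ⟨hx₁, hx₂⟩ ⟨hy₁, hy₂⟩
    simp [hx₁, hx₂, hy₁, hy₂]
  zero_mem' := by simp
  smul_mem' := by
    rintro c x ⟨hx₁, hx₂⟩
    simp [hx₁, hx₂]

/-- The unitary identification of `E ⊕ (F ⊕ G)` with `F ⊕ (E ⊕ G)` that permutes the
components. -/
def reorder : WithLp 2 (E × WithLp 2 (F × G)) ≃ₗᵢ[ℂ] WithLp 2 (F × WithLp 2 (E × G)) where
  toFun x := WithLp.toLp 2 (x.snd.fst, WithLp.toLp 2 (x.fst, x.snd.snd))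
  invFun y := WithLp.toLp 2 (y.snd.fst, WithLp.toLp 2 (y.fst, y.snd.snd))
  left_inv _ := rfl
  right_inv _ := rfl
  map_add' _ _ := rfl
  map_smul' _ _ := rfl
  norm_map' x := by
    change ‖(WithLp.toLp 2 (x.snd.fst, WithLp.toLp 2 (x.fst, x.snd.snd)) :
      WithLp 2 (F × WithLp 2 (E × G)))‖ = ‖x‖
    rw [← sq_eq_sq₀ (norm_nonneg _) (norm_nonneg _)]
    simp only [WithLp.prod_norm_sq_eq_of_L2, WithLp.toLp_fst, WithLp.toLp_snd]
    ring

theorem reorder_apply (x : WithLp 2 (E × WithLp 2 (F × G))) :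
    reorder E F G x = WithLp.toLp 2 (x.snd.fst, WithLp.toLp 2 (x.fst, x.snd.snd)) := rfl

end Blocks

end BlockOperators

end

/-! Both $\mathcal K_1$ and $\mathcal H_0$ are invariant under $R_0$, and the quotients by them
carry $R$ and $V$. So the coordinate projections $P$ (`outerProj`) onto $\mathcal H$ and $Q$ onto
$\mathcal K$ satisfy $PR_0=RP$ and $QR_0=VQ$. As $\|x\|\le\|Px\|+\|Qx\|$, the map $x\mapsto(Px,Qx)$
makes $R_0$ similar to a restriction of $R\oplus V$.

For (1) this gives $\|p(R)\|\le\|p(R_0)\|\le\|p(R)\|+\|p(V)\|$ (`norm_aeval_le_of_retract`,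
`norm_aeval_le_add`). For (2), similarity to a contraction passes to the quotient $R$
(`SimilarToContraction.of_retract`) and, when $V$ is an isometry, back from $R$ to $R_0$
(`SimilarToContraction.of_isometry`). -/

open ContinuousLinearMap

namespace BlockOperators

universe u₁ u₂ u₃

/-! ### Polynomial calculus under intertwining maps -/

section Intertwining

variable {E : Type u₁} {F : Type u₂} {G : Type u₃}
  [NormedAddCommGroup E] [InnerProductSpace ℂ E]
  [NormedAddCommGroup F] [InnerProductSpace ℂ F]
  [NormedAddCommGroup G] [InnerProductSpace ℂ G]

theorem comp_aeval_of_intertwine {P : E →L[ℂ] F} {S : E →L[ℂ] E} {R : F →L[ℂ] F}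
    (h : P ∘L S = R ∘L P) (p : Polynomial ℂ) :
    P ∘L Polynomial.aeval S p = Polynomial.aeval R p ∘L P := by
  have hpow : ∀ n : ℕ, P ∘L (S ^ n) = (R ^ n) ∘L P := by
    intro n
    induction n with
    | zero => ext x; simp
    | succ n ih =>
      ext x
      have h₁ := DFunLike.congr_fun ih (S x)
      have h₂ := DFunLike.congr_fun h x
      simp only [comp_apply] at h₁ h₂
      simp only [comp_apply, pow_succ, mul_apply_eq_comp, h₁, h₂]
  induction p using Polynomial.induction_on' with
  | add p q hp hq => simp only [map_add, comp_add, add_comp, hp, hq]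
  | monomial n a =>
    simp only [← Polynomial.C_mul_X_pow_eq_monomial, map_mul, map_pow, Polynomial.aeval_X,
      Polynomial.aeval_C, Algebra.algebraMap_eq_smul_one, smul_mul_assoc, one_mul, comp_smul,
      smul_comp, hpow]

/-- The polynomial calculus of an operator is controlled by that of a retract intertwined
with it. -/
theorem norm_aeval_le_of_retract {P : E →L[ℂ] F} {J : F →L[ℂ] E} {S : E →L[ℂ] E}
    {R : F →L[ℂ] F} (hP : ‖P‖ ≤ 1) (hJ : ‖J‖ ≤ 1) (hPJ : ∀ y, P (J y) = y)
    (h : P ∘L S = R ∘L P) (p : Polynomial ℂ) :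
    ‖Polynomial.aeval R p‖ ≤ ‖Polynomial.aeval S p‖ := by
  -- Only `P` intertwines; `J` is a mere right inverse of it.
  have hR : Polynomial.aeval R p = P ∘L (Polynomial.aeval S p ∘L J) := by
    ext y
    have := DFunLike.congr_fun (comp_aeval_of_intertwine h p) (J y)
    simp only [comp_apply, hPJ] at this
    simp [this]
  rw [hR]
  calc _ ≤ ‖P‖ * ‖Polynomial.aeval S p ∘L J‖ := opNorm_comp_le _ _
    _ ≤ 1 * (‖Polynomial.aeval S p‖ * ‖J‖) := by
      gcongr
      exact opNorm_comp_le _ _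
    _ ≤ 1 * (‖Polynomial.aeval S p‖ * 1) := by gcongr
    _ = _ := by ring

/-- `P` and `Q` carry $p(S)$ to $p(R)$ and $p(V)$, and together they control the norm. -/
theorem norm_aeval_le_add {P : E →L[ℂ] F} {Q : E →L[ℂ] G} {S : E →L[ℂ] E}
    {R : F →L[ℂ] F} {V : G →L[ℂ] G} (hP : ‖P‖ ≤ 1) (hQ : ‖Q‖ ≤ 1)
    (hPQ : ∀ x, ‖x‖ ≤ ‖P x‖ + ‖Q x‖) (hR : P ∘L S = R ∘L P) (hV : Q ∘L S = V ∘L Q)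
    (p : Polynomial ℂ) :
    ‖Polynomial.aeval S p‖ ≤ ‖Polynomial.aeval R p‖ + ‖Polynomial.aeval V p‖ := by
  refine opNorm_le_bound _ (by positivity) fun x => ?_
  have h₁ := DFunLike.congr_fun (comp_aeval_of_intertwine hR p) x
  have h₂ := DFunLike.congr_fun (comp_aeval_of_intertwine hV p) x
  simp only [comp_apply] at h₁ h₂
  refine (hPQ _).trans ?_
  rw [h₁, h₂, add_mul]
  have hPx : ‖P x‖ ≤ ‖x‖ := by simpa using P.le_of_opNorm_le hP x
  have hQx : ‖Q x‖ ≤ ‖x‖ := by simpa using Q.le_of_opNorm_le hQ x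
  exact add_le_add (le_opNorm_of_le _ hPx) (le_opNorm_of_le _ hQx)

theorem PowerBounded.of_norm_aeval_le {S : E →L[ℂ] E} {R : F →L[ℂ] F}
    (h : ∀ p : Polynomial ℂ, ‖Polynomial.aeval R p‖ ≤ ‖Polynomial.aeval S p‖)
    (hS : PowerBounded S) : PowerBounded R := by
  obtain ⟨C, hC⟩ := hS
  exact ⟨C, fun n hn => le_trans (by simpa using h (Polynomial.X ^ n)) (hC n hn)⟩

theorem PolynomiallyBounded.of_norm_aeval_le {S : E →L[ℂ] E} {R : F →L[ℂ] F}
    (h : ∀ p : Polynomial ℂ, ‖Polynomial.aeval R p‖ ≤ ‖Polynomial.aeval S p‖)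
    (hS : PolynomiallyBounded S) : PolynomiallyBounded R := by
  obtain ⟨M, hM, hb⟩ := hS
  exact ⟨M, hM, fun p => (h p).trans (hb p)⟩

theorem PowerBounded.of_norm_aeval_le_add {S : E →L[ℂ] E} {R : F →L[ℂ] F} {V : G →L[ℂ] G}
    (h : ∀ p : Polynomial ℂ,
      ‖Polynomial.aeval S p‖ ≤ ‖Polynomial.aeval R p‖ + ‖Polynomial.aeval V p‖)
    (hR : PowerBounded R) (hV : PowerBounded V) : PowerBounded S := by
  obtain ⟨C, hC⟩ := hR
  obtain ⟨D, hD⟩ := hV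
  exact ⟨C + D, fun n hn =>
    le_trans (by simpa using h (Polynomial.X ^ n)) (add_le_add (hC n hn) (hD n hn))⟩

theorem PolynomiallyBounded.of_norm_aeval_le_add {S : E →L[ℂ] E} {R : F →L[ℂ] F}
    {V : G →L[ℂ] G}
    (h : ∀ p : Polynomial ℂ,
      ‖Polynomial.aeval S p‖ ≤ ‖Polynomial.aeval R p‖ + ‖Polynomial.aeval V p‖)
    (hR : PolynomiallyBounded R) (hV : PolynomiallyBounded V) : PolynomiallyBounded S := by
  obtain ⟨C, hC, hbC⟩ := hR
  obtain ⟨D, hD, hbD⟩ := hV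
  refine ⟨C + D, by positivity, fun p => (h p).trans ?_⟩
  rw [add_mul]
  exact add_le_add (hbC p) (hbD p)

end Intertwining

/-! ### Similarity to a contraction -/

section Contractions

variable {E : Type u₁} {F : Type u₂} {G : Type u₃}
  [NormedAddCommGroup E] [InnerProductSpace ℂ E]
  [NormedAddCommGroup F] [InnerProductSpace ℂ F]
  [NormedAddCommGroup G] [InnerProductSpace ℂ G]

/-- The modulus of a bounded operator between Hilbert spaces. -/
theorem exists_isSelfAdjoint_norm_eq [CompleteSpace E] [CompleteSpace F] (S : E →L[ℂ] F) :
    ∃ Y : E →L[ℂ] E, IsSelfAdjoint Y ∧ ∀ x, ‖Y x‖ = ‖S x‖ := by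
  have hG : (0 : E →L[ℂ] E) ≤ adjoint S ∘L S := by
    rw [ContinuousLinearMap.nonneg_iff_isPositive]
    exact isPositive_adjoint_comp_self S
  have hY : IsSelfAdjoint (CFC.sqrt (adjoint S ∘L S)) :=
    IsSelfAdjoint.of_nonneg (CFC.sqrt_nonneg _)
  refine ⟨CFC.sqrt (adjoint S ∘L S), hY, fun x => ?_⟩
  have hsq := CFC.sqrt_mul_sqrt_self (adjoint S ∘L S) hG
  rw [← sq_eq_sq₀ (norm_nonneg _) (norm_nonneg _), apply_norm_sq_eq_inner_adjoint_left,
    apply_norm_sq_eq_inner_adjoint_left, hY.adjoint_eq]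
  exact congrArg (fun Z : E →L[ℂ] E => RCLike.re (inner ℂ (Z x) x)) hsq

/-- An operator that is a contraction for an equivalent Hilbertian seminorm is similar to a
contraction. -/
theorem SimilarToContraction.of_bounded_below [CompleteSpace E] [CompleteSpace F]
    {R : E →L[ℂ] E} (S : E →L[ℂ] F) {c : ℝ} (hS : ∀ x, ‖x‖ ≤ c * ‖S x‖)
    (hR : ∀ x, ‖S (R x)‖ ≤ ‖S x‖) : SimilarToContraction R := by
  -- The modulus gives the same seminorm as `S` but acts on `E`, so the contraction can live on `E`
  -- itself, in the required universe.
  obtain ⟨Y, hsa, hY⟩ := exists_isSelfAdjoint_norm_eq S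
  have hc : ∀ x, ‖x‖ ≤ (c.toNNReal : ℝ) * ‖Y x‖ := fun x => by
    rw [hY]
    exact (hS x).trans (by gcongr; exact Real.le_coe_toNNReal c)
  have hanti : AntilipschitzWith c.toNNReal Y := Y.antilipschitz_of_bound hc
  have hker : Y.ker = ⊥ := LinearMap.ker_eq_bot.2 hanti.injective
  -- The range is closed because `Y` is bounded below, and dense because its orthogonal complement
  -- is $\ker Y^*=\ker Y=0$.
  have hrange : Y.range = ⊤ := by
    have hcl : IsClosed (Y.range : Set E) := hanti.isClosed_range Y.uniformContinuous
    rw [← hcl.submodule_topologicalClosure_eq, Submodule.topologicalClosure_eq_top_iff,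
      orthogonal_range, hsa.adjoint_eq, hker]
  let X : E ≃L[ℂ] E := ContinuousLinearEquiv.ofBijective Y hker hrange
  have hX : ∀ x, X x = Y x := fun x => rfl
  refine ⟨E, _, _, ‹_›, (X : E →L[ℂ] E) ∘L R ∘L (X.symm : E →L[ℂ] E), ?_, X, ?_⟩
  · refine opNorm_le_bound _ zero_le_one fun x => ?_
    have h := hR (X.symm x)
    rw [← hY, ← hY, ← hX, ← hX, X.apply_symm_apply] at h
    simpa using h
  · ext x
    simp

/-- Similarity to a contraction passes to quotients by invariant subspaces. -/
theorem SimilarToContraction.of_retract [CompleteSpace F] {S : E →L[ℂ] E} {R : F →L[ℂ] F}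
    {P : E →L[ℂ] F} {J : F →L[ℂ] E} (hPJ : ∀ y, P (J y) = y) (h : P ∘L S = R ∘L P)
    (hS : SimilarToContraction S) : SimilarToContraction R := by
  obtain ⟨L, _, _, _, T, hT, X, hX⟩ := hS
  have hXS : ∀ x, X (S x) = T (X x) := fun x => DFunLike.congr_fun hX x
  have hPS : ∀ x, P (S x) = R (P x) := fun x => DFunLike.congr_fun h x
  -- the image under `X` of the kernel of `P`
  let M : Submodule ℂ L := (P ∘L (X.symm : L →L[ℂ] E)).ker
  have hM : ∀ m, m ∈ M ↔ P (X.symm m) = 0 := fun m => Iff.rfl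
  have hTM : ∀ m ∈ M, T m ∈ M := fun m hm => by
    have : T m = X (S (X.symm m)) := by rw [hXS, X.apply_symm_apply]
    rw [hM, this, X.symm_apply_apply, hPS, (hM m).1 hm, map_zero]
  have : CompleteSpace M :=
    (P ∘L (X.symm : L →L[ℂ] E)).isClosed_ker.completeSpace_coe
  -- The quotient $L/M$ is realised as $M^\perp$; the Hilbertian seminorm on `F` is
  -- $y\mapsto\|QXJy\|$.
  let Q : L →L[ℂ] L := Mᗮ.starProjection
  have hsub : ∀ y, y - Q y ∈ M := fun y => by
    have := Submodule.sub_starProjection_mem_orthogonal (K := Mᗮ) y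
    rwa [Submodule.orthogonal_orthogonal] at this
  have hQM : ∀ m ∈ M, Q m = 0 := fun m hm =>
    (Submodule.starProjection_apply_eq_zero_iff Mᗮ).2 (M.le_orthogonal_orthogonal hm)
  have hQ : ∀ y, ‖Q y‖ ≤ ‖y‖ := fun y => Submodule.norm_starProjection_apply_le Mᗮ y
  refine .of_bounded_below (Q ∘L (X : E →L[ℂ] L) ∘L J)
    (c := ‖P ∘L (X.symm : L →L[ℂ] E)‖) (fun y => ?_) (fun y => ?_)
  -- $PX^{-1}$ kills `M`, so it still recovers `y` after `Q` is applied.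
  · have hy : (P ∘L (X.symm : L →L[ℂ] E)) (Q (X (J y))) = y := by
      have := (hM _).1 (hsub (X (J y)))
      rw [map_sub, map_sub, X.symm_apply_apply, hPJ, sub_eq_zero] at this
      exact this.symm
    conv_lhs => rw [← hy]
    exact le_opNorm _ _
  -- `J` need not intertwine, but $JRy-SJy\in\ker P$, which `X` sends into `M`, where `Q` vanishes.
  · have h₁ : Q (X (J (R y))) = Q (T (X (J y))) := by
      rw [← sub_eq_zero, ← map_sub, ← hXS, ← map_sub]
      refine hQM _ ((hM _).2 ?_)
      rw [X.symm_apply_apply, map_sub, hPJ, hPS, hPJ, sub_self]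
    have h₂ : Q (T (X (J y))) = Q (T (Q (X (J y)))) := by
      rw [← sub_eq_zero, ← map_sub, ← map_sub]
      exact hQM _ (hTM _ (hsub _))
    simp only [comp_apply, ContinuousLinearEquiv.coe_coe]
    rw [h₁, h₂]
    refine (hQ _).trans ?_
    simpa using T.le_of_opNorm_le hT (Q (X (J y)))

/-- The map $Wx=(XPx,Qx)$ is bounded below and intertwines `S` with the contraction $T\oplus V$. -/
theorem SimilarToContraction.of_isometry [CompleteSpace E] [CompleteSpace G]
    {S : E →L[ℂ] E} {R : F →L[ℂ] F} {V : G →L[ℂ] G} {P : E →L[ℂ] F} {Q : E →L[ℂ] G}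
    (hPQ : ∀ x, ‖x‖ ≤ ‖P x‖ + ‖Q x‖)
    (hP : P ∘L S = R ∘L P) (hQ : Q ∘L S = V ∘L Q) (hV : Isometry V)
    (hR : SimilarToContraction R) : SimilarToContraction S := by
  obtain ⟨L, _, _, _, T, hT, X, hX⟩ := hR
  have hXR : ∀ x, X (R x) = T (X x) := fun x => DFunLike.congr_fun hX x
  have hPS : ∀ x, P (S x) = R (P x) := fun x => DFunLike.congr_fun hP x
  have hQS : ∀ x, Q (S x) = V (Q x) := fun x => DFunLike.congr_fun hQ x
  let W : E →L[ℂ] WithLp 2 (L × G) :=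
    ((WithLp.prodContinuousLinearEquiv 2 ℂ L G).symm : (L × G) →L[ℂ] WithLp 2 (L × G)) ∘L
      (((X : F →L[ℂ] L) ∘L P).prod Q)
  have hW : ∀ x, ‖W x‖ ^ 2 = ‖X (P x)‖ ^ 2 + ‖Q x‖ ^ 2 := fun x =>
    WithLp.prod_norm_sq_eq_of_L2 (W x)
  -- The constant adds $\|Px\|\le\|X^{-1}\|\,\|Wx\|$ and $\|Qx\|\le\|Wx\|$.
  refine .of_bounded_below W (c := ‖(X.symm : L →L[ℂ] F)‖ + 1) (fun x => ?_) (fun x => ?_)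
  · have h₁ : ‖X (P x)‖ ≤ ‖W x‖ :=
      (sq_le_sq₀ (norm_nonneg _) (norm_nonneg _)).1 (by rw [hW]; nlinarith [sq_nonneg ‖Q x‖])
    have h₂ : ‖Q x‖ ≤ ‖W x‖ :=
      (sq_le_sq₀ (norm_nonneg _) (norm_nonneg _)).1 (by rw [hW]; nlinarith [sq_nonneg ‖X (P x)‖])
    have h₃ : ‖P x‖ ≤ ‖(X.symm : L →L[ℂ] F)‖ * ‖W x‖ := by
      have := (X.symm : L →L[ℂ] F).le_opNorm_of_le h₁
      simpa using this
    linarith [hPQ x]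
  · refine (sq_le_sq₀ (norm_nonneg _) (norm_nonneg _)).1 ?_
    rw [hW, hW, hPS, hQS, hXR, hV.norm_map_of_map_zero (map_zero V)]
    gcongr
    simpa using T.le_of_opNorm_le hT (X (P x))

end Contractions

/-! ### The coordinate projections of $E\oplus F\oplus G$ -/

section Compressions

variable (E : Type u₁) (F : Type u₂) (G : Type u₃)
  [NormedAddCommGroup E] [InnerProductSpace ℂ E]
  [NormedAddCommGroup F] [InnerProductSpace ℂ F]
  [NormedAddCommGroup G] [InnerProductSpace ℂ G]

/-- The projection of `E ⊕ (F ⊕ G)` onto `E ⊕ G`. -/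
noncomputable def outerProj : WithLp 2 (E × WithLp 2 (F × G)) →L[ℂ] WithLp 2 (E × G) :=
  WithLp.sndL 2 ℂ F (WithLp 2 (E × G)) ∘L
    ((reorder E F G).toContinuousLinearEquiv :
      WithLp 2 (E × WithLp 2 (F × G)) →L[ℂ] WithLp 2 (F × WithLp 2 (E × G)))

theorem outerProj_apply (x : WithLp 2 (E × WithLp 2 (F × G))) :
    outerProj E F G x = WithLp.toLp 2 (x.fst, x.snd.snd) := rfl

/-- The inclusion of `E ⊕ G` into `E ⊕ (F ⊕ G)`. -/
noncomputable def outerIncl : WithLp 2 (E × G) →ₗᵢ[ℂ] WithLp 2 (E × WithLp 2 (F × G)) where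
  toFun x := WithLp.toLp 2 (x.fst, WithLp.toLp 2 (0, x.snd))
  map_add' x y := by
    apply WithLp.ofLp_injective
    ext <;> simp [← WithLp.toLp_add]
  map_smul' c x := by
    apply WithLp.ofLp_injective
    ext <;> simp [← WithLp.toLp_smul]
  norm_map' x := by
    rw [← sq_eq_sq₀ (norm_nonneg _) (norm_nonneg _)]
    simp [WithLp.prod_norm_sq_eq_of_L2]

theorem outerProj_outerIncl (y : WithLp 2 (E × G)) :
    outerProj E F G (outerIncl E F G y) = y := rfl

theorem norm_sq_outerProj (x : WithLp 2 (E × WithLp 2 (F × G))) :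
    ‖outerProj E F G x‖ ^ 2 = ‖x.fst‖ ^ 2 + ‖x.snd.snd‖ ^ 2 :=
  WithLp.prod_norm_sq_eq_of_L2 (outerProj E F G x)

theorem norm_outerProj_le : ‖outerProj E F G‖ ≤ 1 := by
  refine opNorm_le_bound _ zero_le_one fun x => ?_
  rw [one_mul, ← sq_le_sq₀ (norm_nonneg _) (norm_nonneg _), norm_sq_outerProj,
    WithLp.prod_norm_sq_eq_of_L2 x, WithLp.prod_norm_sq_eq_of_L2 x.snd]
  linarith [sq_nonneg ‖x.snd.fst‖]

theorem norm_sndL_le : ‖WithLp.sndL 2 ℂ E F‖ ≤ 1 := by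
  refine opNorm_le_bound _ zero_le_one fun x => ?_
  rw [one_mul, ← sq_le_sq₀ (norm_nonneg _) (norm_nonneg _), WithLp.prod_norm_sq_eq_of_L2 x]
  exact le_add_of_nonneg_left (sq_nonneg ‖x.fst‖)

/-- Every component is seen by at least one projection; the one in `G` is seen by both. -/
theorem norm_le_outerProj_add_snd (x : WithLp 2 (E × WithLp 2 (F × G))) :
    ‖x‖ ≤ ‖outerProj E F G x‖ + ‖WithLp.sndL 2 ℂ E (WithLp 2 (F × G)) x‖ := by
  rw [← sq_le_sq₀ (norm_nonneg _) (by positivity), WithLp.prod_norm_sq_eq_of_L2 x, add_sq,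
    norm_sq_outerProj]
  change _ ≤ _ + _ + ‖x.snd‖ ^ 2
  have : 0 ≤ 2 * ‖outerProj E F G x‖ * ‖WithLp.sndL 2 ℂ E (WithLp 2 (F × G)) x‖ := by
    positivity
  linarith [sq_nonneg ‖x.snd.snd‖]

end Compressions

end BlockOperators

theorem proposition2p5
    {H₀ : Type*} {H₁ : Type*} {K₁ : Type*}
    [NormedAddCommGroup H₀] [InnerProductSpace ℂ H₀] [CompleteSpace H₀]
    [NormedAddCommGroup H₁] [InnerProductSpace ℂ H₁] [CompleteSpace H₁]
    [NormedAddCommGroup K₁] [InnerProductSpace ℂ K₁] [CompleteSpace K₁]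
    (T₀ : H₀ →L[ℂ] H₀) (T₁ : H₁ →L[ℂ] H₁) (V₁ : K₁ →L[ℂ] K₁)
    (K : H₁ →L[ℂ] K₁) (A : H₁ →L[ℂ] H₀)
    (V : WithLp 2 (K₁ × H₁) →L[ℂ] WithLp 2 (K₁ × H₁))
    (hV : V = BlockOperators.block2
      V₁ K
      0  T₁)
    (R : WithLp 2 (H₀ × H₁) →L[ℂ] WithLp 2 (H₀ × H₁))
    (hR : R = BlockOperators.block2
      T₀ A
      0  T₁)
    (R₀ : WithLp 2 (H₀ × WithLp 2 (K₁ × H₁)) →L[ℂ] WithLp 2 (H₀ × WithLp 2 (K₁ × H₁)))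
    (hR₀ : R₀ = BlockOperators.block3
      T₀ 0  A
      0  V₁ K
      0  0  T₁) :
    -- `K₁` is an invariant subspace of `R₀`
    (∀ x ∈ BlockOperators.middleSummand H₀ K₁ H₁,
      R₀ x ∈ BlockOperators.middleSummand H₀ K₁ H₁) ∧
    -- the form of `R₀` with respect to `K₁ ⊕ H`, where `H = H₀ ⊕ H₁`
    (∃ B : WithLp 2 (H₀ × H₁) →L[ℂ] K₁, ∀ x,
      BlockOperators.reorder H₀ K₁ H₁ (R₀ x) =
        BlockOperators.block2
          V₁ B
          0  R (BlockOperators.reorder H₀ K₁ H₁ x)) ∧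
    -- (1)
    (BlockOperators.PowerBounded V →
      (BlockOperators.PowerBounded R ↔ BlockOperators.PowerBounded R₀)) ∧
    (BlockOperators.PolynomiallyBounded V →
      (BlockOperators.PolynomiallyBounded R ↔ BlockOperators.PolynomiallyBounded R₀)) ∧
    -- (2)
    (Isometry V →
      (BlockOperators.SimilarToContraction R ↔ BlockOperators.SimilarToContraction R₀)) := by
  have hP : BlockOperators.outerProj H₀ K₁ H₁ ∘L R₀ = R ∘L BlockOperators.outerProj H₀ K₁ H₁ := by
    ext x
    simp [hR, hR₀, BlockOperators.outerProj_apply, BlockOperators.block2_apply,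
      BlockOperators.block3_apply]
  have hQ : WithLp.sndL 2 ℂ H₀ (WithLp 2 (K₁ × H₁)) ∘L R₀ =
      V ∘L WithLp.sndL 2 ℂ H₀ (WithLp 2 (K₁ × H₁)) := by
    ext x
    simp [hV, hR₀, BlockOperators.block2_apply, BlockOperators.block3_apply]
  have hle := BlockOperators.norm_aeval_le_of_retract
    (BlockOperators.norm_outerProj_le H₀ K₁ H₁)
    (BlockOperators.outerIncl H₀ K₁ H₁).norm_toContinuousLinearMap_le
    (BlockOperators.outerProj_outerIncl H₀ K₁ H₁) hP
  have hadd := BlockOperators.norm_aeval_le_add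
    (BlockOperators.norm_outerProj_le H₀ K₁ H₁)
    (BlockOperators.norm_sndL_le H₀ (WithLp 2 (K₁ × H₁)))
    (BlockOperators.norm_le_outerProj_add_snd H₀ K₁ H₁) hP hQ
  -- The corner `B` is $(0\;\;K)$, since $\mathcal H_0$ does not feed into $\mathcal K_1$.
  refine ⟨?_, ⟨K ∘L WithLp.sndL 2 ℂ H₀ H₁, fun x => ?_⟩,
    fun hVb => ⟨fun h => .of_norm_aeval_le_add hadd h hVb, .of_norm_aeval_le hle⟩,
    fun hVb => ⟨fun h => .of_norm_aeval_le_add hadd h hVb, .of_norm_aeval_le hle⟩,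
    fun hVi => ⟨.of_isometry (BlockOperators.norm_le_outerProj_add_snd H₀ K₁ H₁) hP hQ hVi,
      .of_retract (J := (BlockOperators.outerIncl H₀ K₁ H₁).toContinuousLinearMap)
        (BlockOperators.outerProj_outerIncl H₀ K₁ H₁) hP⟩⟩
  · rintro x ⟨hx₁, hx₂⟩
    subst hR₀
    exact ⟨by simp [BlockOperators.block3_apply, hx₁, hx₂],
      by simp [BlockOperators.block3_apply, hx₂]⟩
  · simp [hR, hR₀, BlockOperators.block2_apply, BlockOperators.block3_apply,
      BlockOperators.reorder_apply]
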